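/- Setting. Let $n,\mathfrak m\ge 1$ be integers and let $x_1,\dots,x_n\in\mathbb R^{\mathfrak m}$ be deterministic design points, possibly not distinct. Let $Y_1,\dots,Y_n$ be independent integrable real random variables with $\mathbb E[Y_i]=f^\star(x_i)$. For $q\in[1,2]$ let $\sigma_q\in[0,+\infty]$ be any number with $\big(\frac1n\sum_{i=1}^n\mathbb E|Y_i-\mathbb E Y_i|^q\big)^{1/q}\le\sigma_q$. For $f,g:\mathbb R^{\mathfrak m}\to\mathbb R$ put $\ell(f,g)=\frac1n\sum_{i=1}^n|f(x_i)-g(x_i)|$, and for a set $\mathcal G$ of such functions put $\ell(f,\mathcal G)=\inf_{g\in\mathcal G}\ell(f,g)$, with $\inf\varnothing=+\infty$. A class $\mathcal A$ of subsets of a set $\mathcal Y$ has VC-dimension at most $D$ if $|\{B\cap A:A\in\mathcal A\}|<2^{|B|}$ for every finite $B\subset\mathcal Y$ with $|B|>D$. An element $\overline g$ of a class $\mathcal G$ of real functions on $\mathcal Y$ is extremal in $\mathcal G$ with degree at most $D$ if the two classes $\{\{g>\overline g\}:g\in\mathcal G\}$ and $\{\{g<\overline g\}:g\in\mathcal G\}$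 have VC-dimension at most $D$. Let $\mathcal S$ be the class of the functions $x\mapsto\phi(\langle\theta,x\rangle)$ on $\mathbb R^{\mathfrak m}$ with $\phi:\mathbb R\to\mathbb R$ monotone (nondecreasing or nonincreasing) and $\theta$ in the Euclidean unit sphere of $\mathbb R^{\mathfrak m}$. For $D\ge1$ let $\mathcal O(D)$ be the set of those $\overline f\in\mathcal S$ whose restriction to $\{x_1,\dots,x_n\}$ is extremal, with degree at most $D$, in the class of restrictions to $\{x_1,\dots,x_n\}$ of the elements of $\mathcal S$. For a constant $\kappa>0$ define the risk bound $$B_n(f^\star,\mathcal S)=\inf_{D\ge1}\Big\{3\,\ell(f^\star,\mathcal O(D))+\kappa\inf_{q\in[1,2]}\Big[\sigma_q\Big(\frac Dn\Big)^{1-1/q}\Big]\Big\}.$$ Corollary. For every constant $\kappa>0$ there is a constant $C>0$, depending only on $\kappa$, such that the following holds in every setting as above. Assume that $\sigma_p<+\infty$ for some $p\in[1,2]$ and that $f^\star=\phi^\star(\langle\theta^\star,\cdot\rangle)\in\mathcal S$, where the monotone link function $\phi^\star$ has finite limits $\phi^\star(\pm\infty)$ at $\pm\infty$, and put $V=|\phi^\star(+\infty)-\phi^\star(-\infty)|$.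 Then $$B_n(f^\star,\mathcal S)\le C\left[\sigma_p^{\frac1{s+1}}\left(\frac{V(\mathfrak m+1)}n\right)^{\frac s{s+1}}+\sigma_p\left(\frac{\mathfrak m+1}n\right)^s\right]\qquad\text{with } s=1-\frac1p .$$ -/

import Mathlib

open scoped ENNReal

namespace FixedDesign

/-- The VC-dimension of the class `𝒜` of subsets of `Y` is not larger than `D`: every finite
subset `B` of `Y` with more than `D` elements satisfies `|{B ∩ A : A ∈ 𝒜}| < 2 ^ |B|`. -/
def VCDimLE {Y : Type*} (𝒜 : Set (Set Y)) (D : ℕ) : Prop :=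
  ∀ B : Finset Y, D < B.card →
    Set.ncard {S : Set Y | ∃ A ∈ 𝒜, S = (B : Set Y) ∩ A} < 2 ^ B.card

/-- `gbar` is an element of `𝒢` that is extremal in `𝒢` with degree not larger than `D`: the
classes of sets `{g > gbar}` and `{g < gbar}`, `g ∈ 𝒢`, both have VC-dimension at most `D`. -/
def IsExtremal {Y : Type*} (𝒢 : Set (Y → ℝ)) (D : ℕ) (gbar : Y → ℝ) : Prop :=
  gbar ∈ 𝒢 ∧
    VCDimLE {A : Set Y | ∃ g ∈ 𝒢, A = {y | gbar y < g y}} D ∧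
    VCDimLE {A : Set Y | ∃ g ∈ 𝒢, A = {y | g y < gbar y}} D

/-- The set `𝒪(D)` of the elements of `ℱ` whose restriction to the set of design points is
extremal, with degree not larger than `D`, in the class of restrictions of elements of `ℱ`. -/
def extremalSet {X : Type*} {n : ℕ} (x : Fin n → X) (ℱ : Set (X → ℝ)) (D : ℕ) : Set (X → ℝ) :=
  {f | f ∈ ℱ ∧ IsExtremal ((fun g : X → ℝ => (Set.range x).domRestrict g) '' ℱ) D
    ((Set.range x).domRestrict f)}

/-- The loss `ℓ(f, g) = n⁻¹ ∑ᵢ |f(xᵢ) - g(xᵢ)|`. -/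
noncomputable def loss {X : Type*} {n : ℕ} (x : Fin n → X) (f g : X → ℝ) : ℝ :=
  (n : ℝ)⁻¹ * ∑ i, |f (x i) - g (x i)|

/-- The distance `ℓ(f, 𝒢) = inf_{g ∈ 𝒢} ℓ(f, g)`, equal to `+∞` when `𝒢` is empty. -/
noncomputable def lossTo {X : Type*} {n : ℕ} (x : Fin n → X) (f : X → ℝ)
    (𝒢 : Set (X → ℝ)) : ℝ≥0∞ :=
  ⨅ g ∈ 𝒢, ENNReal.ofReal (loss x f g)

/-- The moment `σ_p(𝐱) = (n⁻¹ ∑ᵢ 𝔼|Yᵢ - 𝔼 Yᵢ|^p)^{1/p}` of the errors, possibly `+∞`. -/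
noncomputable def errorMoment {Ω : Type*} [MeasurableSpace Ω] (μ : MeasureTheory.Measure Ω)
    {n : ℕ} (Y : Fin n → Ω → ℝ) (p : ℝ) : ℝ≥0∞ :=
  ((n : ℝ≥0∞)⁻¹ * ∑ i, ∫⁻ ω, ENNReal.ofReal (|Y i ω - ∫ ω', Y i ω' ∂μ| ^ p) ∂μ) ^ (1 / p)

/-- The risk bound `B_n(f, ℱ) = inf_{D ≥ 1} {3 ℓ(f, 𝒪(D)) + κ inf_{p ∈ [1, 2]} σ_p (D/n)^{1 - 1/p}}`
for given values `σ_p ∈ [0, +∞]`, `p ∈ [1, 2]`. -/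
noncomputable def riskBound (κ : ℝ) (σ : ℝ → ℝ≥0∞) {X : Type*} {n : ℕ} (x : Fin n → X)
    (f : X → ℝ) (ℱ : Set (X → ℝ)) : ℝ≥0∞ :=
  ⨅ (D : ℕ) (_ : 1 ≤ D),
    (3 * lossTo x f (extremalSet x ℱ D) +
      ENNReal.ofReal κ *
        ⨅ p ∈ Set.Icc (1 : ℝ) 2, σ p * ENNReal.ofReal (((D : ℝ) / n) ^ (1 - 1 / p)))

/-- The monotone single index class: the functions `x ↦ φ(⟨θ, x⟩)` on `ℝ^m` with `φ` monotone
(in either direction) on `ℝ` and `θ` in the unit sphere. -/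
def singleIndexClass (m : ℕ) : Set (EuclideanSpace ℝ (Fin m) → ℝ) :=
  {f | ∃ (φ : ℝ → ℝ) (θ : EuclideanSpace ℝ (Fin m)),
    (Monotone φ ∨ Antitone φ) ∧ ‖θ‖ = 1 ∧ f = fun x => φ (inner ℝ θ x)}

end FixedDesign

namespace FixedDesign

/-! Round the link to `k` levels: `f⋆` moves by at most `V / k`, and the rounded function `g` is
still single index. It is also extremal of degree `k (m + 1)`: on a level set `{g = c}`, the set `{h
> g}` is `{h > c}`, convex with convex complement, so by Radon's theorem `m + 2` points of one level
are never shattered (`vcDimLE_of_piecewise_convex`). Hence the risk bound is at most `3 V / k + κ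
σ_p (k (m + 1) / n) ^ s` for every `k ≥ 1` (`riskBound_le`), and `exists_balancing_nat` picks `k` to
equalize the two terms up to rounding. -/

/-- A proper trace of a class on a finite set witnesses that the set is not shattered. -/
theorem ncard_trace_lt {Y : Type*} {𝒜 : Set (Set Y)} {B : Finset Y} {S : Set Y}
    (hSB : S ⊆ (B : Set Y)) (hS : ∀ A ∈ 𝒜, S ≠ (B : Set Y) ∩ A) :
    Set.ncard {S : Set Y | ∃ A ∈ 𝒜, S = (B : Set Y) ∩ A} < 2 ^ B.card := by
  rw [← Set.ncard_coe_finset B, ← Set.ncard_powerset (B : Set Y) B.finite_toSet]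
  refine Set.ncard_lt_ncard ⟨?_, fun h => ?_⟩ B.finite_toSet.powerset
  · rintro _ ⟨A, -, rfl⟩
    exact Set.inter_subset_left
  · obtain ⟨A, hA, h'⟩ := h (Set.mem_powerset hSB)
    exact hS A hA h'

/-- If the sets of a class coincide, on each of `k` pieces, with half-spaces of a space of
dimension `d`, then the class has VC-dimension at most `k (d + 1)`. -/
theorem vcDimLE_of_piecewise_convex {E : Type*} [AddCommGroup E] [Module ℝ E]
    [FiniteDimensional ℝ E] {P : Set E} {R : Type*} [DecidableEq R] {𝒜 : Set (Set P)}
    (g : P → R) (T : Finset R) (hg : ∀ y, g y ∈ T)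
    (h𝒜 : ∀ A ∈ 𝒜, ∀ c, ∃ H : Set E, Convex ℝ H ∧ Convex ℝ Hᶜ ∧
      ∀ y : P, g y = c → (y ∈ A ↔ (y : E) ∈ H)) :
    VCDimLE 𝒜 (T.card * (Module.finrank ℝ E + 1)) := by
  intro B hB
  -- Pigeonhole: some piece contains at least `d + 2` points of `B`, too many to be affinely
  -- independent.
  obtain ⟨c, -, hc⟩ := Finset.exists_lt_card_fiber_of_mul_lt_card_of_maps_to
    (fun y _ => hg y) hB
  set F := B.filter (fun y => g y = c) with hF
  have hdep : ¬ AffineIndependent ℝ (fun y : F => ((y : P) : E)) := by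
    intro h
    have h1 := h.card_le_finrank_succ
    have h2 := Submodule.finrank_le (vectorSpan ℝ (Set.range fun y : F => ((y : P) : E)))
    rw [Fintype.card_coe] at h1
    omega
  obtain ⟨I, z, hzI, hzIc⟩ := Convex.radon_partition hdep
  -- The Radon part `I` is a missing trace: otherwise `H` and `Hᶜ` would contain the hulls of `I`
  -- and of its complement in `F`, which share `z`.
  refine ncard_trace_lt (S := (fun y : F => (y : P)) '' I) ?_ ?_
  · rintro _ ⟨y, -, rfl⟩
    exact (Finset.mem_filter.1 y.2).1
  · intro A hA hS
    obtain ⟨H, hH, hHc, hAH⟩ := h𝒜 A hA c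
    have hmem : ∀ y : F, y ∈ I ↔ ((y : P) : E) ∈ H := by
      intro y
      have hy := Finset.mem_filter.1 y.2
      rw [← hAH y hy.2]
      constructor
      · intro hyI
        have : (y : P) ∈ (B : Set P) ∩ A := hS ▸ ⟨y, hyI, rfl⟩
        exact this.2
      · intro hyA
        have : (y : P) ∈ (fun y : F => (y : P)) '' I := hS ▸ ⟨hy.1, hyA⟩
        obtain ⟨y', hy', he⟩ := this
        rwa [← Subtype.ext he]
    refine convexHull_min ?_ hHc hzIc (convexHull_min ?_ hH hzI)
    · rintro _ ⟨y, hy, rfl⟩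
      exact fun h => hy ((hmem y).2 h)
    · rintro _ ⟨y, hy, rfl⟩
      exact (hmem y).1 hy

/-- The strict superlevel sets of a single index function are half-spaces. -/
theorem convex_superlevel_of_mem_singleIndexClass {m : ℕ}
    {h : EuclideanSpace ℝ (Fin m) → ℝ} (hh : h ∈ singleIndexClass m) (c : ℝ) :
    Convex ℝ {z | c < h z} ∧ Convex ℝ {z | c < h z}ᶜ := by
  obtain ⟨ψ, η, hψ, -, rfl⟩ := hh
  have key : ∀ s : Set ℝ, Convex ℝ s → Convex ℝ {z | inner ℝ η z ∈ s} := fun s hs =>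
    hs.linear_preimage (innerₛₗ ℝ η)
  have h2 : {z | c < ψ (inner ℝ η z)}ᶜ = {z | inner ℝ η z ∈ {r | ψ r ≤ c}} := by
    ext z; simp
  rw [h2]
  rcases hψ with hψ | hψ
  · have hup : IsUpperSet {r | c < ψ r} := fun a b hab h => lt_of_lt_of_le h (hψ hab)
    exact ⟨key _ hup.ordConnected.convex, key _ (hψ.convex_le c)⟩
  · exact ⟨key _ (hψ.convex_gt c), key _ (hψ.convex_le c)⟩

/-- The strict sublevel sets of a single index function are half-spaces. -/
theorem convex_sublevel_of_mem_singleIndexClass {m : ℕ}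
    {h : EuclideanSpace ℝ (Fin m) → ℝ} (hh : h ∈ singleIndexClass m) (c : ℝ) :
    Convex ℝ {z | h z < c} ∧ Convex ℝ {z | h z < c}ᶜ := by
  have hneg : -h ∈ singleIndexClass m := by
    obtain ⟨ψ, η, hψ, hη, rfl⟩ := hh
    exact ⟨-ψ, η, hψ.symm.imp Antitone.neg Monotone.neg, hη, rfl⟩
  simpa using convex_superlevel_of_mem_singleIndexClass hneg (-c)

/-- A single index function with at most `k` values is extremal with degree `k (m + 1)`. -/
theorem mem_extremalSet_of_finite_range {m n : ℕ} (x : Fin n → EuclideanSpace ℝ (Fin m))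
    {g : EuclideanSpace ℝ (Fin m) → ℝ} (hg : g ∈ singleIndexClass m) (T : Finset ℝ)
    (hT : ∀ z, g z ∈ T) {k : ℕ} (hk : T.card ≤ k) :
    g ∈ extremalSet x (singleIndexClass m) (k * (m + 1)) := by
  have hle : T.card * (Module.finrank ℝ (EuclideanSpace ℝ (Fin m)) + 1) ≤ k * (m + 1) := by
    rw [finrank_euclideanSpace_fin]
    exact Nat.mul_le_mul_right _ hk
  refine ⟨hg, ⟨g, hg, rfl⟩, fun B hB => ?_, fun B hB => ?_⟩
  · refine vcDimLE_of_piecewise_convex (fun y => g y) T (fun y => hT y) ?_ B (hle.trans_lt hB)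
    rintro _ ⟨_, ⟨h, hh, rfl⟩, rfl⟩ c
    obtain ⟨h1, h2⟩ := convex_superlevel_of_mem_singleIndexClass hh c
    exact ⟨_, h1, h2, fun y hy => by subst hy; rfl⟩
  · refine vcDimLE_of_piecewise_convex (fun y => g y) T (fun y => hT y) ?_ B (hle.trans_lt hB)
    rintro _ ⟨_, ⟨h, hh, rfl⟩, rfl⟩ c
    obtain ⟨h1, h2⟩ := convex_sublevel_of_mem_singleIndexClass hh c
    exact ⟨_, h1, h2, fun y hy => by subst hy; rfl⟩

/-- A monotone quantizer with at most `k` values, of precision `δ` on `[lo, lo + k δ]`. -/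
theorem exists_monotone_quantizer (lo δ : ℝ) (hδ : 0 ≤ δ) {k : ℕ} (hk : 1 ≤ k) :
    ∃ (G : ℝ → ℝ) (T : Finset ℝ), Monotone G ∧ (∀ w, G w ∈ T) ∧ T.card ≤ k ∧
      ∀ w, lo ≤ w → w ≤ lo + k * δ → |w - G w| ≤ δ := by
  -- Capping at `k - 1` keeps `k` values; the right endpoint, where the floor is `k`, still has
  -- error only `δ`.
  refine ⟨fun w => lo + δ * (min ⌊(w - lo) / δ⌋₊ (k - 1) : ℕ),
    (Finset.range k).image fun j : ℕ => lo + δ * (j : ℝ), ?_, ?_, ?_, ?_⟩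
  · intro a b hab
    dsimp only
    gcongr
  · intro w
    refine Finset.mem_image_of_mem _ (Finset.mem_range.2 ?_)
    omega
  · exact Finset.card_image_le.trans (Finset.card_range k).le
  · intro w h1 h2
    rcases hδ.eq_or_lt with rfl | hδ
    · have : w = lo := by linarith
      simp [this]
    · have hu : (0 : ℝ) ≤ (w - lo) / δ := div_nonneg (by linarith) hδ.le
      have hw : w = lo + δ * ((w - lo) / δ) := by field_simp; ring
      have huk : (w - lo) / δ ≤ k := by rw [div_le_iff₀ hδ]; linarith
      set u := (w - lo) / δ
      have hfl : (⌊u⌋₊ : ℝ) ≤ u := Nat.floor_le hu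
      have hlt : u < ⌊u⌋₊ + 1 := Nat.lt_floor_add_one u
      have hk1 : ((k - 1 : ℕ) : ℝ) = k - 1 := by rw [Nat.cast_sub hk]; simp
      have hmin : |u - (min ⌊u⌋₊ (k - 1) : ℕ)| ≤ 1 := by
        rw [abs_le]
        rcases le_total ⌊u⌋₊ (k - 1) with h | h
        · rw [min_eq_left h]; constructor <;> linarith
        · rw [min_eq_right h, hk1]
          have : ((k - 1 : ℕ) : ℝ) ≤ ⌊u⌋₊ := by exact_mod_cast h
          rw [hk1] at this
          constructor <;> linarith
      calc |w - (lo + δ * (min ⌊u⌋₊ (k - 1) : ℕ))|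
          = δ * |u - (min ⌊u⌋₊ (k - 1) : ℕ)| := by
            rw [← abs_of_pos hδ, ← abs_mul, abs_of_pos hδ]
            congr 1
            linarith
        _ ≤ δ := mul_le_of_le_one_right hδ.le hmin

/-- A monotone function takes its values between its limits. -/
theorem mem_uIcc_of_tendsto {φ : ℝ → ℝ} (hφ : Monotone φ ∨ Antitone φ) {a b : ℝ}
    (ha : Filter.Tendsto φ Filter.atBot (nhds a)) (hb : Filter.Tendsto φ Filter.atTop (nhds b))
    (t : ℝ) : φ t ∈ Set.uIcc a b := by
  rcases hφ with hφ | hφ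
  · exact Set.Icc_subset_uIcc ⟨hφ.le_of_tendsto ha t, hφ.ge_of_tendsto hb t⟩
  · exact Set.Icc_subset_uIcc' ⟨hφ.le_of_tendsto hb t, hφ.ge_of_tendsto ha t⟩

/-- Single index functions with bounded link are approximated by extremal ones. -/
theorem lossTo_extremalSet_le {m n : ℕ} (hn : 1 ≤ n) (x : Fin n → EuclideanSpace ℝ (Fin m))
    {φ : ℝ → ℝ} {θ : EuclideanSpace ℝ (Fin m)} (hφ : Monotone φ ∨ Antitone φ) (hθ : ‖θ‖ = 1)
    {a b : ℝ} (hab : ∀ t, φ t ∈ Set.uIcc a b) {k : ℕ} (hk : 1 ≤ k) :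
    lossTo x (fun z => φ (inner ℝ θ z)) (extremalSet x (singleIndexClass m) (k * (m + 1))) ≤
      ENNReal.ofReal (|b - a| / k) := by
  have hk0 : (0 : ℝ) < k := by exact_mod_cast hk
  obtain ⟨G, T, hG, hGT, hT, hGδ⟩ :=
    exists_monotone_quantizer (min a b) (|b - a| / k) (by positivity) hk
  have hmem : (fun z => G (φ (inner ℝ θ z))) ∈
      extremalSet x (singleIndexClass m) (k * (m + 1)) := by
    refine mem_extremalSet_of_finite_range x ⟨G ∘ φ, θ, ?_, hθ, rfl⟩ T (fun z => hGT _) hT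
    exact hφ.imp hG.comp hG.comp_antitone
  refine (iInf₂_le _ hmem).trans (ENNReal.ofReal_le_ofReal ?_)
  have hn0 : (0 : ℝ) < n := by exact_mod_cast hn
  unfold loss
  rw [inv_mul_le_iff₀ hn0]
  refine (Finset.sum_le_card_nsmul _ _ (|b - a| / k) fun i _ => ?_).trans_eq (by simp)
  obtain ⟨h1, h2⟩ := hab (inner ℝ θ (x i))
  refine hGδ _ h1 (h2.trans_eq ?_)
  rw [mul_div_cancel₀ _ hk0.ne', ← max_sub_min_eq_abs]
  ring

/-- The bound on the risk bound given by step functions with `k` values. -/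
theorem riskBound_le {m n : ℕ} (hn : 1 ≤ n) (x : Fin n → EuclideanSpace ℝ (Fin m))
    {φ : ℝ → ℝ} {θ : EuclideanSpace ℝ (Fin m)} (hφ : Monotone φ ∨ Antitone φ) (hθ : ‖θ‖ = 1)
    {a b : ℝ} (hab : ∀ t, φ t ∈ Set.uIcc a b) {k : ℕ} (hk : 1 ≤ k) {κ : ℝ} (hκ : 0 ≤ κ)
    {σ : ℝ → ℝ≥0∞} {p : ℝ} (hp : p ∈ Set.Icc (1 : ℝ) 2) (hσ : σ p ≠ ∞) :
    riskBound κ σ x (fun z => φ (inner ℝ θ z)) (singleIndexClass m) ≤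
      ENNReal.ofReal (3 * (|b - a| / k) +
        κ * ((σ p).toReal * (k * (((m : ℝ) + 1) / n)) ^ (1 - 1 / p))) := by
  have hD : 1 ≤ k * (m + 1) := Nat.mul_pos hk m.succ_pos
  refine (iInf₂_le _ hD).trans ?_
  rw [ENNReal.ofReal_add (by positivity) (by positivity), ENNReal.ofReal_mul (by norm_num),
    ENNReal.ofReal_mul hκ, ENNReal.ofReal_mul ENNReal.toReal_nonneg, ENNReal.ofReal_toReal hσ,
    ENNReal.ofReal_ofNat]
  gcongr
  · exact lossTo_extremalSet_le hn x hφ hθ hab hk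
  · refine (iInf₂_le p hp).trans_eq ?_
    push_cast
    rw [mul_div_assoc]

/-- The choice of the number of values balancing approximation and estimation. -/
theorem exists_balancing_nat {V a t s : ℝ} (hV : 0 ≤ V) (ha : 0 < a) (ht : 0 < t) (hs : 0 ≤ s)
    (hs1 : s ≤ 1) :
    ∃ k : ℕ, 1 ≤ k ∧ V / k ≤ a ^ (1 / (s + 1)) * (V * t) ^ (s / (s + 1)) ∧
      a * (k * t) ^ s ≤ a ^ (1 / (s + 1)) * (V * t) ^ (s / (s + 1)) + a * t ^ s := by
  rcases hV.eq_or_lt with rfl | hV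
  -- For `V = 0` the balancing value below could be `0`, so `k = 1` is taken directly.
  · exact ⟨1, le_rfl, by simp; positivity, by simp; positivity⟩
  have hs0 : s + 1 ≠ 0 := by positivity
  have hq : s / (s + 1) = 1 - 1 / (s + 1) := by field_simp; ring
  -- `r` is the real solution of `V / r = a * (r * t) ^ s`; the common value is checked through
  -- logarithms.
  set r := (V / (a * t ^ s)) ^ (1 / (s + 1)) with hr
  have hr0 : 0 < r := by positivity
  have hlog : Real.log r = (Real.log V - Real.log a - s * Real.log t) / (s + 1) := by
    rw [hr, Real.log_rpow (by positivity), Real.log_div (by positivity) (by positivity),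
      Real.log_mul (by positivity) (by positivity), Real.log_rpow ht]
    ring
  have hM : Real.log (a ^ (1 / (s + 1)) * (V * t) ^ (s / (s + 1))) =
      (Real.log a + s * (Real.log V + Real.log t)) / (s + 1) := by
    rw [Real.log_mul (by positivity) (by positivity), Real.log_rpow ha,
      Real.log_rpow (by positivity), Real.log_mul hV.ne' ht.ne']
    ring
  have h1 : V / r = a ^ (1 / (s + 1)) * (V * t) ^ (s / (s + 1)) := by
    refine Real.log_injOn_pos (Set.mem_Ioi.2 (by positivity)) (Set.mem_Ioi.2 (by positivity)) ?_
    rw [hM, Real.log_div hV.ne' hr0.ne', hlog]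
    field_simp
    ring
  have h2 : a * (r * t) ^ s = a ^ (1 / (s + 1)) * (V * t) ^ (s / (s + 1)) := by
    refine Real.log_injOn_pos (Set.mem_Ioi.2 (by positivity)) (Set.mem_Ioi.2 (by positivity)) ?_
    rw [hM, Real.log_mul ha.ne' (by positivity), Real.log_rpow (by positivity),
      Real.log_mul hr0.ne' ht.ne', hlog]
    field_simp
    ring
  -- Rounding up only lowers `V / k`; since `k ≤ r + 1` and `u ↦ u ^ s` is subadditive for `s ≤ 1`,
  -- it costs the extra `a * t ^ s`.
  refine ⟨⌈r⌉₊, Nat.ceil_pos.2 hr0, ?_, ?_⟩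
  · rw [← h1]
    gcongr
    exact Nat.le_ceil r
  · rw [← h2, ← mul_add]
    gcongr
    calc ((⌈r⌉₊ : ℝ) * t) ^ s ≤ (r * t + t) ^ s := by
          gcongr
          nlinarith [Nat.ceil_lt_add_one hr0.le]
      _ ≤ (r * t) ^ s + t ^ s := Real.rpow_add_le_add_rpow (by positivity) ht.le hs hs1

end FixedDesign

theorem mainTheorem10 (κ : ℝ) (hκ : 0 < κ) :
    ∃ C : ℝ, 0 < C ∧
      ∀ (m n : ℕ) (_ : 1 ≤ m) (_ : 1 ≤ n)
        (x : Fin n → EuclideanSpace ℝ (Fin m))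
        (φ : ℝ → ℝ) (θ : EuclideanSpace ℝ (Fin m)) (fstar : EuclideanSpace ℝ (Fin m) → ℝ)
        (_ : Monotone φ ∨ Antitone φ) (_ : ‖θ‖ = 1)
        (_ : fstar = fun z => φ (inner ℝ θ z))
        (φbot φtop V : ℝ)
        (_ : Filter.Tendsto φ Filter.atBot (nhds φbot))
        (_ : Filter.Tendsto φ Filter.atTop (nhds φtop))
        (_ : V = |φtop - φbot|)
        (Ω : Type*) (_ : MeasurableSpace Ω) (μ : MeasureTheory.Measure Ω)
        (_ : MeasureTheory.IsProbabilityMeasure μ)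
        (Y : Fin n → Ω → ℝ)
        (_ : ProbabilityTheory.iIndepFun Y μ)
        (_ : ∀ i, MeasureTheory.Integrable (Y i) μ)
        (_ : ∀ i, ∫ ω, Y i ω ∂μ = fstar (x i))
        (σ : ℝ → ℝ≥0∞)
        (_ : ∀ q ∈ Set.Icc (1 : ℝ) 2, FixedDesign.errorMoment μ Y q ≤ σ q)
        (p s : ℝ) (_ : p ∈ Set.Icc (1 : ℝ) 2) (_ : σ p ≠ ∞) (_ : s = 1 - 1 / p),
        FixedDesign.riskBound κ σ x fstar (FixedDesign.singleIndexClass m) ≤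
          ENNReal.ofReal
            (C * ((σ p).toReal ^ (1 / (s + 1)) * (V * ((m : ℝ) + 1) / n) ^ (s / (s + 1)) +
              (σ p).toReal * (((m : ℝ) + 1) / n) ^ s)) := by

  refine ⟨3 + κ, by positivity, ?_⟩
  intro m n _ hn x φ θ fstar hφ hθ hf φbot φtop V hbot htop hV Ω _ μ _ Y _ _ _ σ _ p s hp hσ hs
  subst hf hV hs
  have hab := FixedDesign.mem_uIcc_of_tendsto hφ hbot htop
  have hp0 : 0 < p := lt_of_lt_of_le one_pos hp.1
  have hs0 : 0 ≤ 1 - 1 / p := by rw [sub_nonneg, div_le_one hp0]; exact hp.1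
  have hs1 : 1 - 1 / p ≤ 1 := by linarith [one_div_pos.2 hp0]
  have hn0 : (0 : ℝ) < n := by exact_mod_cast hn
  rcases (ENNReal.toReal_nonneg (a := σ p)).eq_or_lt with ha | ha
  -- When `σ_p = 0` the estimation term vanishes for every `k`, so letting `k → ∞` gives risk bound
  -- `0`.
  · have hlim : Filter.Tendsto (fun k : ℕ => ENNReal.ofReal (3 * (|φtop - φbot| / k)))
        Filter.atTop (nhds 0) := by
      have := (tendsto_const_div_atTop_nhds_zero_nat |φtop - φbot|).const_mul 3
      simpa using ENNReal.tendsto_ofReal this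
    refine le_trans (ge_of_tendsto hlim ?_) zero_le
    filter_upwards [Filter.eventually_ge_atTop 1] with k hk
    simpa [← ha] using FixedDesign.riskBound_le hn x hφ hθ hab hk hκ.le hp hσ
  · obtain ⟨k, hk, h1, h2⟩ := FixedDesign.exists_balancing_nat (abs_nonneg (φtop - φbot)) ha
      (show 0 < ((m : ℝ) + 1) / n by positivity) hs0 hs1
    refine (FixedDesign.riskBound_le hn x hφ hθ hab hk hκ.le hp hσ).trans
      (ENNReal.ofReal_le_ofReal ?_)
    rw [mul_div_assoc |φtop - φbot|]
    have h3 := mul_le_mul_of_nonneg_left h2 hκ.le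
    have h4 : 0 ≤ (σ p).toReal * (((m : ℝ) + 1) / n) ^ (1 - 1 / p) := by positivity
    linarith
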